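/- For non-negative integers $n,r,s$ let $a_n(r,s)=\sum_{k=0}^n \binom{n}{k}^r\binom{n+k}{k}^s$ denote the generalised Apéry numbers. Let $r$ and $s$ be positive integers, let $m\ge 0$, and let $n=n_0+3n_1+9n_2+\dots+3^m n_m$ be a non-negative integer, where $0\le n_i\le 2$ for all $i$. Then $$a_n(r,s)\equiv \prod_{i=0}^m a_{n_i}(r,s)+3\sum_{\nu=1}^m\Bigl(\prod_{\substack{0\le i\le m\\ i\ne \nu-1,\nu}} a_{n_i}(r,s)\Bigr) f(n_{\nu-1},n_\nu;r,s)\pmod 9,$$ where, for integers $x,y$, $$f(x,y;r,s)=x(x+1)y\Bigl(s(y+1)+(-1)^s\bigl(s(y-1)+ry\bigr)\Bigr)+\chi(r=1)\,(x+2)(x+1)y+\chi(s=1)\,\bigl((-1)^r-1\bigr)(x-1)x\,y^2,$$ and $\chi(\mathcal S)=1$ if $\mathcal S$ is true and $\chi(\mathcal S)=0$ otherwise. -/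

import Mathlib

/-- The generalised Apéry number `a_n(r,s) = ∑_{k=0}^n (n choose k)^r (n+k choose k)^s`. -/
def aperyNumber (n r s : ℕ) : ℕ :=
  ∑ k ∈ Finset.range (n + 1), n.choose k ^ r * (n + k).choose k ^ s

/-- The correction term `f(x,y;r,s)` attached to a pair of adjacent ternary digits
`x` (the lower one) and `y` (the higher one). -/
def digitCorrection (x y : ℤ) (r s : ℕ) : ℤ :=
  x * (x + 1) * y * ((s : ℤ) * (y + 1) + (-1) ^ s * ((s : ℤ) * (y - 1) + (r : ℤ) * y))
    + (if r = 1 then 1 else 0) * (x + 2) * (x + 1) * y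
    + (if s = 1 then 1 else 0) * ((-1) ^ r - 1) * (x - 1) * x * y ^ 2

/-! Write n = 3N + x and k = 3K + c. Modulo 9 the two binomials are C(N,K) and C(N+K,K), each times
a constant plus 3 times a polynomial of degree at most one in N and K. Hence a_n is a_x a_N plus 3
times a weighted sum of a linear correction (`aperyNumber_three_mul_add`). That sum matters only
modulo 3, where Lucas's theorem with N = 3M + y factors it as a_M f(x,y)
(`sum_summandCorrection_zmod_three`).

So a_n ≡ a_x a_N + 3 a_M f(x,y) modulo 9. Induction on the number of digits, with a_M modulo 3 equal
to the product over its digits, gives the formula. -/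

/-! ### Binomial coefficients modulo 9 -/

theorem choose_add_three_succ (n k : ℕ) :
    (n + 3).choose (k + 3) =
      n.choose k + 3 * n.choose (k + 1) + 3 * n.choose (k + 2) + n.choose (k + 3) := by
  simp only [Nat.choose_succ_succ' (n + 2), Nat.choose_succ_succ' (n + 1), Nat.choose_succ_succ' n]
  ring

/-- The absorption identity in a commutative ring. -/
theorem cast_succ_mul_choose_succ (R : Type*) [CommRing R] (n k : ℕ) :
    ((k : R) + 1) * (n.choose (k + 1) : R) = ((n : R) - k) * (n.choose k : R) := by
  rcases le_or_gt k n with h | h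
  · have := Nat.choose_succ_right_eq n k
    have h2 := congrArg (Nat.cast : ℕ → R) this
    push_cast [Nat.cast_sub h] at h2
    linear_combination h2
  · simp [Nat.choose_eq_zero_of_lt h, Nat.choose_eq_zero_of_lt (Nat.lt_succ_of_lt h)]

theorem nine_eq_zero : (9 : ZMod 9) = 0 := rfl

/-- These are the coefficients of (1+X)^(3N) ≡ (1+X³)^N + 3N(X+X²)(1+X³)^(N-1), since N·C(N-1,K) =
(N-K)·C(N,K). The induction multiplies by (1+X)³ through `choose_add_three_succ`. -/
theorem choose_three_mul_zmod_nine (N : ℕ) : ∀ K : ℕ,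
    ((3 * N).choose (3 * K) : ZMod 9) = N.choose K ∧
    ((3 * N).choose (3 * K + 1) : ZMod 9) = 3 * ((N : ZMod 9) - K) * N.choose K ∧
    ((3 * N).choose (3 * K + 2) : ZMod 9) = 3 * ((N : ZMod 9) - K) * N.choose K := by
  have h9 := nine_eq_zero
  induction N with
  | zero => intro K; cases K <;> simp [mul_add]
  | succ N ih =>
    rintro (_ | K)
    · obtain ⟨h0, h1, h2⟩ := ih 0
      simp only [mul_zero, zero_add, mul_add, mul_one] at *
      have e1 : (3 * N + 3).choose 1 = 3 * N + 3 := by simp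
      have e2 : (3 * N + 3).choose 2 = (3 * N).choose 2 + 3 * (3 * N).choose 1 + 3 := by
        simp only [Nat.choose_succ_succ' (3 * N + 2) 1, Nat.choose_succ_succ' (3 * N + 1) 1,
          Nat.choose_succ_succ' (3 * N) 1, Nat.choose_one_right]
        ring
      rw [e1, e2]
      push_cast
      rw [h1, h2]
      simp only [Nat.choose_zero_right, Nat.cast_one, Nat.cast_zero]
      refine ⟨trivial, by ring, by linear_combination (N : ZMod 9) * h9⟩
    · obtain ⟨h0, h1, h2⟩ := ih K
      obtain ⟨g0, g1, g2⟩ := ih (K + 1)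
      have e0 := choose_add_three_succ (3 * N) (3 * K)
      have e1 := choose_add_three_succ (3 * N) (3 * K + 1)
      have e2 := choose_add_three_succ (3 * N) (3 * K + 2)
      have i3 : 3 * (N + 1) = 3 * N + 3 := by ring
      have j0 : 3 * (K + 1) = 3 * K + 3 := by ring
      simp only [i3, j0, add_assoc, Nat.reduceAdd] at *
      rw [e0, e1, e2, Nat.choose_succ_succ' N K]
      push_cast at *
      rw [h0, h1, h2, g0, g1, g2]
      refine ⟨?_, ?_, ?_⟩
      · linear_combination (2 * ((N : ZMod 9) - K) * N.choose K) * h9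
      · linear_combination (((N : ZMod 9) - K) * N.choose K) * h9
      · linear_combination (((N : ZMod 9) - K - 1) * N.choose (K + 1)) * h9

theorem choose_three_mul_add_one_zmod_nine (N K : ℕ) :
    ((3 * N + 1).choose (3 * K) : ZMod 9) = (1 + 3 * (K : ZMod 9)) * N.choose K ∧
    ((3 * N + 1).choose (3 * K + 1) : ZMod 9) = (1 + 3 * ((N : ZMod 9) - K)) * N.choose K ∧
    ((3 * N + 1).choose (3 * K + 2) : ZMod 9) = 6 * ((N : ZMod 9) - K) * N.choose K := by
  obtain ⟨h0, h1, h2⟩ := choose_three_mul_zmod_nine N K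
  refine ⟨?_, ?_, ?_⟩
  · cases K with
    | zero => simp
    | succ K =>
      obtain ⟨-, -, g2⟩ := choose_three_mul_zmod_nine N K
      have := cast_succ_mul_choose_succ (ZMod 9) N K
      rw [show 3 * (K + 1) = 3 * K + 2 + 1 by ring] at *
      rw [Nat.choose_succ_succ']
      push_cast
      rw [h0, g2]
      linear_combination -3 * this
  · rw [Nat.choose_succ_succ']; push_cast; rw [h0, h1]; ring
  · rw [Nat.choose_succ_succ']; push_cast; rw [h1, h2]; ring

theorem choose_three_mul_add_two_zmod_nine (N K : ℕ) :
    ((3 * N + 2).choose (3 * K) : ZMod 9) = N.choose K ∧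
    ((3 * N + 2).choose (3 * K + 1) : ZMod 9) = (2 + 3 * (N : ZMod 9)) * N.choose K ∧
    ((3 * N + 2).choose (3 * K + 2) : ZMod 9) = N.choose K := by
  have h9 := nine_eq_zero
  obtain ⟨h0, h1, h2⟩ := choose_three_mul_add_one_zmod_nine N K
  refine ⟨?_, ?_, ?_⟩
  · cases K with
    | zero => simp
    | succ K =>
      obtain ⟨-, -, g2⟩ := choose_three_mul_add_one_zmod_nine N K
      have := cast_succ_mul_choose_succ (ZMod 9) N K
      rw [show 3 * (K + 1) = 3 * K + 2 + 1 by ring] at *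
      rw [Nat.choose_succ_succ']
      push_cast at *
      rw [h0, g2]
      linear_combination -6 * this + ((K : ZMod 9) + 1) * N.choose (K + 1) * h9
  · rw [Nat.choose_succ_succ']; push_cast; rw [h0, h1]; ring
  · rw [Nat.choose_succ_succ']; push_cast; rw [h1, h2]
    linear_combination ((N : ZMod 9) - K) * N.choose K * h9

/-- Serves the carries in `choose_add_zmod_nine`, where the upper index becomes 3(N+K+1) or one
more. The difference is left unsimplified so that it matches there as a rewrite rule. -/
theorem cast_succ_mul_choose_add_succ (R : Type*) [CommRing R] (n k : ℕ) :
    ((n + k + 1 : ℕ) - k : R) * ((n + k + 1).choose k : R) =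
      ((n : R) + k + 1) * ((n + k).choose k : R) := by
  have h := Nat.add_one_mul_choose_eq (n + k) n
  rw [Nat.choose_symm_of_eq_add (rfl : n + k = n + k),
    Nat.choose_symm_of_eq_add (by omega : n + k + 1 = (n + 1) + k)] at h
  have h2 := congrArg (Nat.cast : ℕ → R) h
  push_cast at h2 ⊢
  linear_combination -h2

/-- The residues modulo `9` of `C(n+k, k)`, by the last ternary digits of `n` and `k`. -/
theorem choose_add_zmod_nine (N K : ℕ) :
    let v : ZMod 9 := (N + K).choose K
    ((3 * N + 3 * K).choose (3 * K) : ZMod 9) = v ∧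
    ((3 * N + (3 * K + 1)).choose (3 * K + 1) : ZMod 9) = (1 + 3 * (N : ZMod 9)) * v ∧
    ((3 * N + (3 * K + 2)).choose (3 * K + 2) : ZMod 9) = v ∧
    ((3 * N + 1 + 3 * K).choose (3 * K) : ZMod 9) = (1 + 3 * (K : ZMod 9)) * v ∧
    ((3 * N + 1 + (3 * K + 1)).choose (3 * K + 1) : ZMod 9) =
      (2 + 3 * ((N : ZMod 9) + K)) * v ∧
    ((3 * N + 1 + (3 * K + 2)).choose (3 * K + 2) : ZMod 9) =
      3 * ((N : ZMod 9) + K + 1) * v ∧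
    ((3 * N + 2 + 3 * K).choose (3 * K) : ZMod 9) = v ∧
    ((3 * N + 2 + (3 * K + 1)).choose (3 * K + 1) : ZMod 9) =
      3 * ((N : ZMod 9) + K + 1) * v ∧
    ((3 * N + 2 + (3 * K + 2)).choose (3 * K + 2) : ZMod 9) =
      6 * ((N : ZMod 9) + K + 1) * v := by
  intro v
  have a := cast_succ_mul_choose_add_succ (ZMod 9) N K
  obtain ⟨h0, -, -⟩ := choose_three_mul_zmod_nine (N + K) K
  obtain ⟨g0, g1, -⟩ := choose_three_mul_add_one_zmod_nine (N + K) K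
  obtain ⟨k0, k1, k2⟩ := choose_three_mul_add_two_zmod_nine (N + K) K
  obtain ⟨-, l1, l2⟩ := choose_three_mul_zmod_nine (N + K + 1) K
  obtain ⟨-, -, m2⟩ := choose_three_mul_add_one_zmod_nine (N + K + 1) K
  rw [mul_assoc, a] at l1 l2 m2
  refine ⟨?_, ?_, ?_, ?_, ?_, ?_, ?_, ?_, ?_⟩
  · rw [← mul_add, h0]
  · rw [show 3 * N + (3 * K + 1) = 3 * (N + K) + 1 by ring, g1]; push_cast; ring
  · rw [show 3 * N + (3 * K + 2) = 3 * (N + K) + 2 by ring, k2]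
  · rw [show 3 * N + 1 + 3 * K = 3 * (N + K) + 1 by ring, g0]
  · rw [show 3 * N + 1 + (3 * K + 1) = 3 * (N + K) + 2 by ring, k1]; push_cast; ring
  · rw [show 3 * N + 1 + (3 * K + 2) = 3 * (N + K + 1) by ring, l2]; ring
  · rw [show 3 * N + 2 + 3 * K = 3 * (N + K) + 2 by ring, k0]
  · rw [show 3 * N + 2 + (3 * K + 1) = 3 * (N + K + 1) by ring, l1]; ring
  · rw [show 3 * N + 2 + (3 * K + 2) = 3 * (N + K + 1) + 1 by ring, m2]; ring

/-! ### Splitting sums by the last ternary digit -/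

theorem sum_range_three_mul {R : Type*} [AddCommMonoid R] (f : ℕ → R) (n : ℕ) :
    ∑ k ∈ Finset.range (3 * n), f k =
      ∑ k ∈ Finset.range n, (f (3 * k) + f (3 * k + 1) + f (3 * k + 2)) := by
  induction n with
  | zero => simp
  | succ n ih =>
    rw [mul_add, mul_one, Finset.sum_range_succ, Finset.sum_range_succ, Finset.sum_range_succ,
      ih, Finset.sum_range_succ, add_assoc, add_assoc, add_assoc]

/-- Positivity of r is essential: the added terms contain 0 ^ r. -/
theorem sum_range_choose_extend {R : Type*} [CommSemiring R] {r : ℕ} (hr : 1 ≤ r) {n L : ℕ}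
    (hL : n + 1 ≤ L) (g : ℕ → R) :
    ∑ k ∈ Finset.range (n + 1), (n.choose k : R) ^ r * g k =
      ∑ k ∈ Finset.range L, (n.choose k : R) ^ r * g k := by
  refine Finset.sum_subset (Finset.range_mono hL) fun k _ hk => ?_
  rw [Nat.choose_eq_zero_of_lt (by simpa using hk), Nat.cast_zero, zero_pow (by omega), zero_mul]

/-- Splitting the sum of `C(n,k)^r C(n+k,k)^s g(k)` by the last ternary digit of `k`. -/
theorem sum_split_last_digit {R : Type*} [CommSemiring R] {r : ℕ} (hr : 1 ≤ r) {N x : ℕ}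
    (hx : x ≤ 2) (g : ℕ → R) :
    ∑ k ∈ Finset.range (3 * N + x + 1), ((3 * N + x).choose k : R) ^ r * g k =
      ∑ K ∈ Finset.range (N + 1),
        (((3 * N + x).choose (3 * K) : R) ^ r * g (3 * K)
          + ((3 * N + x).choose (3 * K + 1) : R) ^ r * g (3 * K + 1)
          + ((3 * N + x).choose (3 * K + 2) : R) ^ r * g (3 * K + 2)) := by
  rw [sum_range_choose_extend hr (by omega : 3 * N + x + 1 ≤ 3 * (N + 1)), sum_range_three_mul]

theorem cast_aperyNumber (R : Type*) [CommSemiring R] (n r s : ℕ) :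
    (aperyNumber n r s : R) =
      ∑ k ∈ Finset.range (n + 1), (n.choose k : R) ^ r * ((n + k).choose k : R) ^ s := by
  simp [aperyNumber]

/-- The linear correction to the summand when a lowest digit `x` is appended to `N`. -/
def summandCorrection (r s x : ℕ) (N K : ℤ) : ℤ :=
  match x with
  | 0 => if r = 1 then 2 * (N - K) else 0
  | 1 => (r + s) * K + (-1) ^ s * (r * (N - K) - s * (N + K))
  | _ => if s = 1 then ((-1) ^ r + 2) * (N + K) else 0

/-! ### Powers modulo 9 and removal of one digit -/

theorem add_three_mul_pow_zmod_nine (a x : ZMod 9) (r : ℕ) :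
    (a + 3 * x) ^ r = a ^ r + 3 * (r * a ^ (r - 1) * x) := by
  have h9 := nine_eq_zero
  cases r with
  | zero => simp
  | succ r =>
    induction r with
    | zero => simp
    | succ r ih =>
      simp only [Nat.add_sub_cancel] at ih ⊢
      rw [pow_succ, ih]
      push_cast
      linear_combination (((r : ZMod 9) + 1) * a ^ r * x ^ 2) * h9

theorem one_add_three_mul_pow_zmod_nine (x : ZMod 9) (r : ℕ) :
    (1 + 3 * x) ^ r = 1 + 3 * (r * x) := by
  simp [add_three_mul_pow_zmod_nine]

theorem three_mul_pow_mul_three_mul_pow_zmod_nine {r s : ℕ} (h : 2 ≤ r + s) (x y : ZMod 9) :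
    (3 * x) ^ r * (3 * y) ^ s = 0 := by
  obtain ⟨t, ht⟩ := Nat.exists_eq_add_of_le h
  calc _ = 9 * (3 ^ t * x ^ r * y ^ s) := by
        rw [mul_pow, mul_pow]
        have : (3 : ZMod 9) ^ r * 3 ^ s = 9 * 3 ^ t := by
          rw [← pow_add, ht, pow_add]; norm_num
        linear_combination (x ^ r * y ^ s) * this
    _ = 0 := by rw [nine_eq_zero, zero_mul]

theorem three_mul_pow_zmod_nine {r : ℕ} (hr : 1 ≤ r) (x : ZMod 9) :
    (3 * x) ^ r = if r = 1 then 3 * x else 0 := by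
  split_ifs with h
  · rw [h, pow_one]
  · simpa using three_mul_pow_mul_three_mul_pow_zmod_nine (s := 0) (by omega : 2 ≤ r + 0) x 0

theorem three_mul_two_pow_zmod_nine (r : ℕ) : (3 : ZMod 9) * 2 ^ r = 3 * (-1) ^ r := by
  rw [show (2 : ZMod 9) = -1 + 3 * 1 by decide, add_three_mul_pow_zmod_nine]
  linear_combination ((r : ZMod 9) * (-1) ^ (r - 1)) * nine_eq_zero

theorem aperyNumber_zero (r s : ℕ) : aperyNumber 0 r s = 1 := by simp [aperyNumber]

theorem aperyNumber_one (r s : ℕ) : aperyNumber 1 r s = 1 + 2 ^ s := by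
  simp [aperyNumber, Finset.sum_range_succ]

theorem aperyNumber_two (r s : ℕ) : aperyNumber 2 r s = 1 + 2 ^ r * 3 ^ s + 6 ^ s := by
  simp [aperyNumber, Finset.sum_range_succ, show Nat.choose 4 2 = 6 from rfl]

/-- Powers of a + 3t are linear in t, and two factors 3 annihilate a term. So the terms c = 1, 2
survive for x = 0 only if r = 1, and for x = 2 only if s = 1; for x = 1 the term c = 2 vanishes. -/
theorem aperyNumber_three_mul_add {r s : ℕ} (hr : 1 ≤ r) (hs : 1 ≤ s) {x : ℕ} (hx : x ≤ 2)
    (N : ℕ) :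
    (aperyNumber (3 * N + x) r s : ZMod 9) =
      ∑ K ∈ Finset.range (N + 1), (N.choose K : ZMod 9) ^ r * ((N + K).choose K : ZMod 9) ^ s *
        (aperyNumber x r s + 3 * (summandCorrection r s x N K : ℤ)) := by
  have h9 := nine_eq_zero
  rw [cast_aperyNumber, sum_split_last_digit hr hx]
  refine Finset.sum_congr rfl fun K _ => ?_
  obtain ⟨v1, v2, v3, v4, v5, v6, v7, v8, v9⟩ := choose_add_zmod_nine N K
  have six (t : ZMod 9) : 6 * t = 3 * (2 * t) := by ring
  generalize hu : (N.choose K : ZMod 9) = u at *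
  generalize hv : ((N + K).choose K : ZMod 9) = v at *
  interval_cases x
  · obtain ⟨u1, u2, u3⟩ := choose_three_mul_zmod_nine N K
    rw [hu] at u1 u2 u3
    simp only [add_zero]
    rw [v1, v2, v3, u1, u2, u3, aperyNumber_zero]
    simp only [summandCorrection]
    simp only [mul_pow, one_add_three_mul_pow_zmod_nine]
    rw [← mul_pow, three_mul_pow_zmod_nine hr]
    split_ifs
    · push_cast
      linear_combination (((N : ZMod 9) - K) * u ^ r * v ^ s * s * N) * h9
    · simp
  · obtain ⟨u1, u2, u3⟩ := choose_three_mul_add_one_zmod_nine N K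
    rw [hu] at u1 u2 u3
    rw [v4, v5, v6, u1, u2, u3, aperyNumber_one]
    simp only [summandCorrection]
    have h0 := three_mul_pow_mul_three_mul_pow_zmod_nine (by omega : 2 ≤ r + s)
      (2 * ((N : ZMod 9) - K)) ((N : ZMod 9) + K + 1)
    have h2 : (3 : ZMod 9) * 2 ^ (s - 1) = - (3 * (-1) ^ s) := by
      rw [three_mul_two_pow_zmod_nine]
      obtain ⟨t, rfl⟩ := Nat.exists_eq_add_of_le' hs
      simp [pow_succ]
    have h3 := three_mul_two_pow_zmod_nine s
    rw [six]
    simp only [mul_pow _ u, mul_pow _ v, add_three_mul_pow_zmod_nine]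
    push_cast
    linear_combination u ^ r * v ^ s * h0 + u ^ r * v ^ s * (
      (r * s * K * K + r * (N - K) * (s * 2 ^ (s - 1) * (N + K))) * h9
      + s * (N + K) * h2 + r * (N - K) * h3)
  · obtain ⟨u1, u2, u3⟩ := choose_three_mul_add_two_zmod_nine N K
    rw [hu] at u1 u2 u3
    rw [v7, v8, v9, u1, u2, u3, aperyNumber_two]
    simp only [summandCorrection]
    rw [six]
    simp only [mul_pow _ u, mul_pow _ v, add_three_mul_pow_zmod_nine, three_mul_pow_zmod_nine hs]
    have c3 : (3 : ZMod 9) ^ s = if s = 1 then 3 else 0 := by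
      simpa using three_mul_pow_zmod_nine hs 1
    have c6 : (6 : ZMod 9) ^ s = if s = 1 then 6 else 0 := by
      have := three_mul_pow_zmod_nine hs 2
      norm_num at this
      exact this
    have h3 := three_mul_two_pow_zmod_nine r
    push_cast
    rw [c3, c6]
    split_ifs
    · linear_combination u ^ r * v ^ s * ((N + K) * h3
        + (r * 2 ^ (r - 1) * N * (N + K + 1)) * h9)
    · simp

/-! ### The correction modulo 3 -/

theorem choose_zmod_three (M L : ℕ) {y c : ℕ} (hy : y ≤ 2) (hc : c ≤ 2) :
    ((3 * M + y).choose (3 * L + c) : ZMod 3) = y.choose c * M.choose L := by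
  have : Fact (Nat.Prime 3) := ⟨Nat.prime_three⟩
  have h := Choose.choose_modEq_choose_mod_mul_choose_div_nat (n := 3 * M + y)
    (k := 3 * L + c) (p := 3)
  rw [show (3 * M + y) % 3 = y by omega, show (3 * M + y) / 3 = M by omega,
    show (3 * L + c) % 3 = c by omega, show (3 * L + c) / 3 = L by omega] at h
  have := (ZMod.natCast_eq_natCast_iff _ _ 3).2 h
  push_cast at this
  exact this

/-- Without a carry this is Lucas. With a carry both sides vanish: the low digit y + c - 3 of the
upper index is less than c. -/
theorem choose_add_zmod_three (M L : ℕ) {y c : ℕ} (hy : y ≤ 2) (hc : c ≤ 2) :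
    ((3 * M + y + (3 * L + c)).choose (3 * L + c) : ZMod 3) =
      (y + c).choose c * (M + L).choose L := by
  rcases le_or_gt (y + c) 2 with h | h
  · rw [show 3 * M + y + (3 * L + c) = 3 * (M + L) + (y + c) by ring, choose_zmod_three _ _ h hc]
  · rw [show 3 * M + y + (3 * L + c) = 3 * (M + L + 1) + (y + c - 3) by omega,
      choose_zmod_three _ _ (by omega) hc]
    have h0 : (y + c - 3).choose c = 0 := Nat.choose_eq_zero_of_lt (by omega)
    have h1 : (((y + c).choose c : ℕ) : ZMod 3) = 0 := by
      interval_cases y <;> interval_cases c <;> first | omega | decide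
    rw [h0, h1]; simp

theorem summandCorrection_zmod_three (r s x : ℕ) (M L y c : ℤ) :
    (summandCorrection r s x (3 * M + y) (3 * L + c) : ZMod 3) = summandCorrection r s x y c := by
  have h3 : (3 : ZMod 3) = 0 := rfl
  unfold summandCorrection
  split <;> [split_ifs; skip; split_ifs] <;> push_cast <;> simp only [h3, zero_mul, zero_add]

/-- A finite check: powers of 0 and ±1 depend only on the parities of the positive exponents, and r,
s otherwise enter through their residues modulo 3 and the tests r = 1, s = 1. -/
theorem sum_summandCorrection_last_digit (r s : ℕ) (hr : 1 ≤ r) (hs : 1 ≤ s) {x y : ℕ}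
    (hx : x ≤ 2) (hy : y ≤ 2) :
    ∑ c ∈ Finset.range 3, (y.choose c : ZMod 3) ^ r * ((y + c).choose c : ZMod 3) ^ s *
      (summandCorrection r s x y c : ℤ) = (digitCorrection x y r s : ℤ) := by
  have h3 : (3 : ZMod 3) = 0 := rfl
  have h2 : (2 : ZMod 3) = -1 := rfl
  have h4 : (4 : ZMod 3) = 1 := rfl
  have h6 : (6 : ZMod 3) = 0 := rfl
  have h12 : (12 : ZMod 3) = 0 := rfl
  have h16 : (16 : ZMod 3) = 1 := rfl
  have h24 : (24 : ZMod 3) = 0 := rfl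
  have hr0 : r ≠ 0 := by omega
  have hs0 : s ≠ 0 := by omega
  have c42 : Nat.choose 4 2 = 6 := rfl
  unfold summandCorrection digitCorrection
  rcases Nat.even_or_odd r with er | er <;> rcases Nat.even_or_odd s with es | es <;>
  interval_cases x <;> interval_cases y <;>
    simp only [Finset.sum_range_succ, Finset.sum_range_zero] <;>
    simp [c42, hr0, hs0, h3, h2, h6, h4, h12, h16, h24, er.neg_one_pow, es.neg_one_pow] <;>
    generalize (r : ZMod 3) = a <;> generalize (s : ZMod 3) = b <;> (try split_ifs) <;>
    first
    | (revert a b; decide)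
    -- The branch s = 1 contradicts the evenness of s.
    | (subst_vars; exact absurd es (by decide))

theorem sum_summandCorrection_zmod_three {r s : ℕ} (hr : 1 ≤ r) (hs : 1 ≤ s) {x y : ℕ}
    (hx : x ≤ 2) (hy : y ≤ 2) (M : ℕ) :
    ∑ K ∈ Finset.range (3 * M + y + 1), ((3 * M + y).choose K : ZMod 3) ^ r *
        (((3 * M + y + K).choose K : ZMod 3) ^ s *
          (summandCorrection r s x (3 * M + y : ℕ) K : ℤ)) =
      aperyNumber M r s * (digitCorrection x y r s : ℤ) := by
  rw [sum_split_last_digit hr hy, ← sum_summandCorrection_last_digit r s hr hs hx hy,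
    cast_aperyNumber, Finset.sum_mul]
  refine Finset.sum_congr rfl fun L _ => ?_
  have key : ∀ c ≤ 2, ((3 * M + y).choose (3 * L + c) : ZMod 3) ^ r *
        (((3 * M + y + (3 * L + c)).choose (3 * L + c) : ZMod 3) ^ s *
          (summandCorrection r s x (3 * M + y : ℕ) (3 * L + c : ℕ) : ℤ)) =
      (M.choose L : ZMod 3) ^ r * ((M + L).choose L : ZMod 3) ^ s *
        ((y.choose c : ZMod 3) ^ r * ((y + c).choose c : ZMod 3) ^ s *
          (summandCorrection r s x y c : ℤ)) := by
    intro c hc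
    rw [choose_zmod_three _ _ hy hc, choose_add_zmod_three _ _ hy hc]
    push_cast
    rw [summandCorrection_zmod_three]
    ring
  have k0 := key 0 (by norm_num)
  rw [add_zero] at k0
  rw [k0, key 1 (by norm_num), key 2 le_rfl]
  simp only [Finset.sum_range_succ, Finset.sum_range_zero]
  ring

/-- The congruence relating `a_n` to the numbers obtained by deleting low ternary digits of `n`. -/
theorem aperyNumber_modEq_nine_of_last_digits {r s : ℕ} (hr : 1 ≤ r) (hs : 1 ≤ s) {x y : ℕ}
    (hx : x ≤ 2) (hy : y ≤ 2) (M : ℕ) :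
    (aperyNumber (3 * (3 * M + y) + x) r s : ℤ) ≡
      aperyNumber x r s * aperyNumber (3 * M + y) r s
        + 3 * (aperyNumber M r s * digitCorrection x y r s) [ZMOD 9] := by
  set N := 3 * M + y with hN
  set W : ℤ := ∑ K ∈ Finset.range (N + 1), (N.choose K : ℤ) ^ r *
    (((N + K).choose K : ℤ) ^ s * summandCorrection r s x N K) with hW
  have h1 : (aperyNumber (3 * N + x) r s : ℤ) ≡
      aperyNumber x r s * aperyNumber N r s + 3 * W [ZMOD 9] := by
    refine (ZMod.intCast_eq_intCast_iff _ _ 9).1 ?_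
    rw [hW]
    push_cast
    rw [aperyNumber_three_mul_add hr hs hx, cast_aperyNumber _ N, Finset.mul_sum, Finset.mul_sum,
      ← Finset.sum_add_distrib]
    exact Finset.sum_congr rfl fun K _ => by ring
  -- W is multiplied by 3, so its class modulo 3 suffices.
  have h2 : W ≡ aperyNumber M r s * digitCorrection x y r s [ZMOD 3] := by
    refine (ZMod.intCast_eq_intCast_iff _ _ 3).1 ?_
    rw [hW]
    push_cast
    exact_mod_cast sum_summandCorrection_zmod_three hr hs hx hy M
  exact h1.trans ((h2.mul_left' (c := 3)).add_left _)

theorem aperyNumber_modEq_three {r s : ℕ} (hr : 1 ≤ r) {y : ℕ} (hy : y ≤ 2) (M : ℕ) :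
    (aperyNumber (3 * M + y) r s : ℤ) ≡ aperyNumber y r s * aperyNumber M r s [ZMOD 3] := by
  refine (ZMod.intCast_eq_intCast_iff _ _ 3).1 ?_
  push_cast
  rw [cast_aperyNumber, sum_split_last_digit hr hy, cast_aperyNumber _ M, cast_aperyNumber _ y,
    sum_range_choose_extend hr (by omega : y + 1 ≤ 3), Finset.mul_sum]
  refine Finset.sum_congr rfl fun L _ => ?_
  have a0 := choose_zmod_three M L hy (Nat.zero_le 2)
  have b0 := choose_add_zmod_three M L hy (Nat.zero_le 2)
  rw [add_zero] at a0 b0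
  rw [a0, b0, choose_zmod_three M L hy one_le_two, choose_add_zmod_three M L hy one_le_two,
    choose_zmod_three M L hy le_rfl, choose_add_zmod_three M L hy le_rfl]
  simp only [Finset.sum_range_succ, Finset.sum_range_zero]
  ring

/-! ### Induction over the digits -/

theorem sum_digits_succ (d : ℕ → ℕ) (m : ℕ) :
    ∑ i ∈ Finset.range (m + 1), d i * 3 ^ i =
      3 * ∑ i ∈ Finset.range m, d (i + 1) * 3 ^ i + d 0 := by
  rw [Finset.sum_range_succ', Finset.mul_sum]
  simp only [pow_zero, mul_one]
  congr 1
  exact Finset.sum_congr rfl fun i _ => by ring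

theorem aperyNumber_modEq_three_prod {r s : ℕ} (hr : 1 ≤ r) (m : ℕ) : ∀ d : ℕ → ℕ,
    (∀ i < m, d i ≤ 2) →
    (aperyNumber (∑ i ∈ Finset.range m, d i * 3 ^ i) r s : ℤ) ≡
      ∏ i ∈ Finset.range m, (aperyNumber (d i) r s : ℤ) [ZMOD 3] := by
  induction m with
  | zero =>
    intro d _
    rw [Finset.sum_range_zero, Finset.prod_range_zero, aperyNumber_zero, Nat.cast_one]
  | succ m ih =>
    intro d hd
    rw [sum_digits_succ, Finset.prod_range_succ', mul_comm (Finset.prod _ _)]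
    exact (aperyNumber_modEq_three hr (hd 0 (by omega)) _).trans
      ((ih (fun i => d (i + 1)) fun i hi => hd _ (by omega)).mul_left _)

theorem prod_filter_ne_adjacent_succ (m ν : ℕ) (f : ℕ → ℤ) :
    ∏ i ∈ (Finset.range (m + 1)).filter (fun i => i ≠ (ν + 1) ∧ i ≠ ν + 2), f i =
      f 0 * ∏ i ∈ (Finset.range m).filter (fun i => i ≠ ν ∧ i ≠ ν + 1), f (i + 1) := by
  rw [Finset.prod_filter, Finset.prod_filter, Finset.prod_range_succ', mul_comm]
  simp

/-- Removing the lowest digit from the correction sum. -/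
theorem sum_correction_succ (m : ℕ) (f : ℕ → ℤ) (g : ℕ → ℕ → ℤ) :
    ∑ ν ∈ Finset.Icc 1 (m + 1),
        (∏ i ∈ (Finset.range (m + 2)).filter (fun i => i ≠ ν - 1 ∧ i ≠ ν), f i) * g (ν - 1) ν =
      (∏ i ∈ Finset.range m, f (i + 2)) * g 0 1 +
      f 0 * ∑ ν ∈ Finset.Icc 1 m,
        (∏ i ∈ (Finset.range (m + 1)).filter (fun i => i ≠ ν - 1 ∧ i ≠ ν), f (i + 1)) *
          g (ν - 1 + 1) (ν + 1) := by
  have e (M : ℕ) (F : ℕ → ℤ) :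
      ∑ ν ∈ Finset.Icc 1 M, F ν = ∑ ν ∈ Finset.range M, F (ν + 1) := by
    rw [Finset.range_eq_Ico, Finset.sum_Ico_add' F 0 M 1]
    rfl
  rw [e, e, Finset.sum_range_succ', add_comm, Finset.mul_sum]
  congr 1
  -- Only for ν = 1 does the excluded pair contain the index 0.
  · congr 1
    rw [Finset.prod_filter, Finset.prod_range_succ', Finset.prod_range_succ']
    simp
  · refine Finset.sum_congr rfl fun ν _ => ?_
    simp only [Nat.add_sub_cancel]
    rw [prod_filter_ne_adjacent_succ, mul_assoc]

theorem theorem1 (r s : ℕ) (hr : 1 ≤ r) (hs : 1 ≤ s) (n m : ℕ) (d : ℕ → ℕ)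
    (hd : ∀ i ≤ m, d i ≤ 2) (hn : n = ∑ i ∈ Finset.range (m + 1), d i * 3 ^ i) :
    (aperyNumber n r s : ℤ) ≡
      ((∏ i ∈ Finset.range (m + 1), (aperyNumber (d i) r s : ℤ))
        + 3 * ∑ ν ∈ Finset.Icc 1 m,
            (∏ i ∈ (Finset.range (m + 1)).filter (fun i => i ≠ ν - 1 ∧ i ≠ ν),
                (aperyNumber (d i) r s : ℤ))
              * digitCorrection (d (ν - 1) : ℤ) (d ν : ℤ) r s) [ZMOD 9] := by
  induction m generalizing n d with
  | zero => subst hn; simp [Int.ModEq.refl]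
  | succ m ih =>
    -- Shifting the digits removes the lowest one, so that the two-digit congruence applies to d 0
    -- and d 1.
    have h1 := ih _ (fun i => d (i + 1)) (fun i hi => hd _ (by omega)) rfl
    have h2 := aperyNumber_modEq_three_prod (s := s) hr m (fun i => d (i + 2))
      fun i hi => hd _ (by omega)
    have e : ∑ i ∈ Finset.range (m + 1), d (i + 1) * 3 ^ i =
        3 * ∑ i ∈ Finset.range m, d (i + 2) * 3 ^ i + d 1 :=
      sum_digits_succ (fun i => d (i + 1)) m
    have h3 := aperyNumber_modEq_nine_of_last_digits hr hs (hd 0 (by omega)) (hd 1 (by omega))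
      (∑ i ∈ Finset.range m, d (i + 2) * 3 ^ i)
    rw [← e, ← sum_digits_succ, ← hn] at h3
    refine h3.trans ?_
    have h4 := (h1.mul_left (aperyNumber (d 0) r s : ℤ)).add
      ((h2.mul_right (digitCorrection (d 0) (d 1) r s)).mul_left' (c := 3))
    refine h4.trans ?_
    rw [sum_correction_succ m (fun i => (aperyNumber (d i) r s : ℤ))
      (fun i j => digitCorrection (d i) (d j) r s), Finset.prod_range_succ' _ (m + 1)]
    exact congrArg (· % 9) (by ring)
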